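/- Let $\mathcal O_n$ denote the ring of germs at $0$ of complex analytic functions $(\mathbb C^n,0)\to\mathbb C$. Let $g=(g_1,\dots,g_s):(\mathbb C^n,0)\to\mathbb C^s$ be an analytic map germ, where $s\le n$. Let $D(g)$ be the submodule of $\mathcal O_n^s$ generated by $\frac{\partial g}{\partial x_1},\dots,\frac{\partial g}{\partial x_n}$, and let $\mathbf J(g)$ be the ideal of $\mathcal O_n$ generated by the maximal ($s\times s$) minors of the $s\times n$ differential matrix $\left(\frac{\partial g_i}{\partial x_j}\right)$. Let $d$ denote the (Krull) dimension of the $\mathcal O_n$-module $\mathcal O_n^s/D(g)$, and suppose that $\mathcal O_n^s/D(g)$ is Cohen–Macaulay and $d\ge 1$. Let $I$ be the ideal of $\mathcal O_n$ generated by a regular sequence $\lambda_1,\dots,\lambda_d$ of $\mathcal O_n$. Then the following conditions are equivalent: (a) $g$ is $I$-consistent, that is, $D(g)\cap I^{\oplus s}=I\,D(g)$, where $I^{\oplus s}=I\oplus\cdots\oplus I\subseteq\mathcal O_n^s$; (b) the ideal $\mathbf J(g)+I$ has finite colength, that is, $\dim_{\mathbb C}\mathcal O_n/(\mathbf J(g)+I)<\infty$;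 (c) $\lambda_1,\dots,\lambda_d$ is a regular sequence with respect to $\mathcal O_n^s/D(g)$. Here $\lambda_1,\dots,\lambda_d\in R$ is a regular sequence with respect to an $R$-module $M$ when $M\ne\langle\lambda_1,\dots,\lambda_d\rangle M$ and $\lambda_i$ is a non-zerodivisor on $M/\langle\lambda_1,\dots,\lambda_{i-1}\rangle M$ for $i=1,\dots,d$; a regular sequence of $R$ is one with respect to $M=R$. -/

import Mathlib

open Filter Topology

noncomputable section

/-- A germ at `0 ∈ ℂⁿ` of a complex valued function is analytic if one (equivalently, every)
representative of it is analytic at `0`. -/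
def Filter.Germ.IsAnalytic {n : ℕ} (φ : Germ (𝓝 (0 : Fin n → ℂ)) ℂ) : Prop :=
  φ.liftOn (fun f => AnalyticAt ℂ f 0) (fun _ _ h => propext (analyticAt_congr h))

/-- The ring `𝓞ₙ` of germs of analytic functions `(ℂⁿ, 0) → ℂ`, as a subring of the ring of all
germs of functions at `0`. -/
def analyticGerms (n : ℕ) : Subring (Germ (𝓝 (0 : Fin n → ℂ)) ℂ) where
  carrier := {φ | φ.IsAnalytic}
  mul_mem' {a b} := Germ.inductionOn₂ a b fun _ _ hf hg => AnalyticAt.mul hf hg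
  one_mem' := (analyticAt_const : AnalyticAt ℂ (fun _ : Fin n → ℂ => (1 : ℂ)) 0)
  add_mem' {a b} := Germ.inductionOn₂ a b fun _ _ hf hg => AnalyticAt.add hf hg
  zero_mem' := (analyticAt_const : AnalyticAt ℂ (fun _ : Fin n → ℂ => (0 : ℂ)) 0)
  neg_mem' {a} := Germ.inductionOn a fun _ hf => AnalyticAt.neg hf

/-- The ring `𝓞ₙ` as a type. -/
abbrev AnalyticGerm (n : ℕ) : Type := analyticGerms n

namespace AnalyticGerm

/-- The germ at `0` of a function that is analytic at `0`. -/
def of {n : ℕ} (f : (Fin n → ℂ) → ℂ) (hf : AnalyticAt ℂ f 0) : AnalyticGerm n :=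
  ⟨(f : Germ (𝓝 (0 : Fin n → ℂ)) ℂ), hf⟩

theorem exists_rep {n : ℕ} (φ : AnalyticGerm n) : ∃ f hf, φ = of f hf := by
  obtain ⟨φ, hφ⟩ := φ
  induction φ using Germ.inductionOn with
  | _ f => exact ⟨f, hφ, rfl⟩

/-- `𝓞ₙ` is a `ℂ`-algebra through the germs of constant functions. -/
instance (n : ℕ) : Algebra ℂ (AnalyticGerm n) :=
  RingHom.toAlgebra
    { toFun := fun c => of (fun _ => c) analyticAt_const
      map_one' := rfl
      map_mul' := fun _ _ => rfl
      map_zero' := rfl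
      map_add' := fun _ _ => rfl }

instance (n : ℕ) : Nontrivial (AnalyticGerm n) :=
  ⟨⟨0, 1, fun h => zero_ne_one
    (congrArg (fun φ : AnalyticGerm n => (φ : Germ (𝓝 (0 : Fin n → ℂ)) ℂ).value) h)⟩⟩

theorem isUnit_of_ne_zero {n : ℕ} (f : (Fin n → ℂ) → ℂ) (hf : AnalyticAt ℂ f 0) (h0 : f 0 ≠ 0) :
    IsUnit (of f hf) := by
  refine IsUnit.of_mul_eq_one (of f⁻¹ (hf.inv h0)) (Subtype.ext (Germ.coe_eq.2 ?_))
  filter_upwards [hf.continuousAt.eventually_ne h0] with x hx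
  exact mul_inv_cancel₀ hx

instance (n : ℕ) : IsLocalRing (AnalyticGerm n) := by
  refine IsLocalRing.of_isUnit_or_isUnit_one_sub_self fun φ => ?_
  obtain ⟨f, hf, rfl⟩ := exists_rep φ
  by_cases h : f 0 = 0
  · exact Or.inr (isUnit_of_ne_zero (fun x => 1 - f x) (analyticAt_const.sub hf) (by simp [h]))
  · exact Or.inl (isUnit_of_ne_zero f hf h)

/-- The partial derivative `∂/∂xⱼ : 𝓞ₙ → 𝓞ₙ`, computed on representatives. -/
def pderiv {n : ℕ} (j : Fin n) (φ : AnalyticGerm n) : AnalyticGerm n :=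
  ⟨Germ.map' (fun f x => fderiv ℂ f x (Pi.single j 1))
      (fun _ _ h => (EventuallyEq.fderiv h).mono fun _ hx =>
        congrArg (fun L : (Fin n → ℂ) →L[ℂ] ℂ => L (Pi.single j 1)) hx) φ.1, by
    obtain ⟨φ, hφ⟩ := φ
    induction φ using Germ.inductionOn with
    | _ f =>
      exact ((ContinuousLinearMap.apply ℂ ℂ (Pi.single j 1 : Fin n → ℂ)).analyticAt _).comp
        (AnalyticAt.fderiv hφ)⟩

/-- The differential matrix `(∂gᵢ/∂xⱼ)`, of size `s × n`, of an analytic map germ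
`g = (g₁, …, gₛ) : (ℂⁿ, 0) → ℂˢ`. -/
def jacobianMatrix {n s : ℕ} (g : Fin s → AnalyticGerm n) :
    Matrix (Fin s) (Fin n) (AnalyticGerm n) :=
  Matrix.of fun i j => pderiv j (g i)

/-- The Jacobian module `D(g) ⊆ 𝓞ₙˢ`, generated by `∂g/∂x₁, …, ∂g/∂xₙ`. -/
def jacobianModule {n s : ℕ} (g : Fin s → AnalyticGerm n) :
    Submodule (AnalyticGerm n) (Fin s → AnalyticGerm n) :=
  Submodule.span (AnalyticGerm n) (Set.range fun j : Fin n => fun i => pderiv j (g i))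

/-- The ideal `𝐉(g)` generated by the maximal minors of the differential matrix of
`g : (ℂⁿ, 0) → ℂˢ`, for `s ≤ n`: the `s × s` minors, one for each choice of `s` columns. -/
def jacobianMinors {n s : ℕ} (g : Fin s → AnalyticGerm n) : Ideal (AnalyticGerm n) :=
  Ideal.span (Set.range fun e : Fin s ↪o Fin n => ((jacobianMatrix g).submatrix id e).det)

/-- `g` is `I`-consistent when `D(g) ∩ I^{⊕ s} = I D(g)`. -/
def IsConsistent {n s : ℕ} (I : Ideal (AnalyticGerm n)) (g : Fin s → AnalyticGerm n) : Prop :=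
  jacobianModule g ⊓ Submodule.pi Set.univ (fun _ : Fin s => I) = I • jacobianModule g

end AnalyticGerm

/-- The depth of a module over a local ring: the supremum of the lengths of the regular sequences
on `M` with elements in the maximal ideal. -/
def moduleDepth (R M : Type*) [CommRing R] [IsLocalRing R] [AddCommGroup M] [Module R M] : ℕ∞ :=
  ⨆ (rs : List R) (_ : (∀ r ∈ rs, r ∈ IsLocalRing.maximalIdeal R) ∧
    RingTheory.Sequence.IsRegular M rs), (rs.length : ℕ∞)

/-- A finitely generated module over a Noetherian local ring is Cohen–Macaulay if it is zero or
its depth is equal to its (Krull) dimension. -/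
def IsCohenMacaulayModule (R M : Type*) [CommRing R] [IsLocalRing R] [AddCommGroup M]
    [Module R M] : Prop :=
  Module.Finite R M ∧
    (Subsingleton M ∨ (moduleDepth R M : WithBot ℕ∞) = Module.supportDim R M)

end

/-! Write `R` for the ring of germs, `F = R^s` and `M = F / D(g)`.

(a) ⇔ (c) is a statement about a submodule `N` of a finite module `F` on which the sequence is
weakly regular: `N ∩ IF = IN` exactly when the sequence is weakly regular on `F / N` (morally,
vanishing of `Tor₁(F/N, R/I)`). One direction is an induction on the length; the other also needs
Nakayama, to pass the equality down to shorter sequences.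

(b) ⇔ (c) rests on `Supp M = V(J(g))`: Cramer's rule shows that the maximal minors kill `M`, and a
determinant expansion puts the `s`-th power of each annihilator of `M` in `J(g)`. So (b) says that
the `λᵢ` cut `Supp M` down to the closed point. A regular sequence of length `d = dim M` does this
because each term lowers the dimension by one. Conversely, `depth M ≤ dim R/p` for every associated
prime `p`, so in a Cohen–Macaulay module no `p` can contain a parameter, and induction on the
sequence applies.

All this needs `R` Noetherian with residue field `ℂ`. Noetherianity follows from Weierstrass
division, proved by inverting an operator close to the identity on the disc algebra. -/

/-! ### Depth, associated primes and systems of parameters -/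

section Depth

universe u

open IsLocalRing RingTheory.Sequence CategoryTheory Abelian Limits Pointwise Module

variable {R : Type u} [CommRing R] [IsLocalRing R] [IsNoetherianRing R]
  {M : Type u} [AddCommGroup M] [Module R M] [Module.Finite R M]

/-- Dividing a finite module by a regular element lowers the depth by at most one. -/
theorem exists_isRegular_quotSMulTop {x : R} (hx : x ∈ maximalIdeal R)
    (hreg : IsSMulRegular M x) (rs : List R) (hmem : ∀ r ∈ rs, r ∈ maximalIdeal R)
    (hrs : IsRegular M rs) :
    ∃ rs' : List R, rs'.length = rs.length - 1 ∧ (∀ r ∈ rs', r ∈ maximalIdeal R) ∧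
      IsRegular (QuotSMulTop x M) rs' := by
  have := hrs.nontrivial
  have hlt : ∀ (N : Type u) [AddCommGroup N] [Module R N] [Module.Finite R N] [Nontrivial N],
      maximalIdeal R • (⊤ : Submodule R N) < ⊤ := fun N _ _ _ _ =>
    (Submodule.top_ne_ideal_smul_of_le_jacobson_annihilator
      (maximalIdeal_le_jacobson _)).symm.lt_top
  have := nontrivial_quotSMulTop_of_mem_maximalIdeal M hx
  let k : ModuleCat.{u} R := ModuleCat.of R (R ⧸ maximalIdeal R)
  have hk : Module.support R k = PrimeSpectrum.zeroLocus (maximalIdeal R) := by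
    change Module.support R (R ⧸ maximalIdeal R) = _
    rw [Module.support_eq_zeroLocus, Ideal.annihilator_quotient]
  have hfin : Module.Finite R k := inferInstanceAs (Module.Finite R (R ⧸ maximalIdeal R))
  have hext := ModuleCat.subsingleton_ext_of_exists_isRegular (maximalIdeal R) k hk.subset
    (ModuleCat.of R M) (hlt M) rs hmem hrs
  refine ModuleCat.exists_isRegular_of_exists_subsingleton_ext (maximalIdeal R) (rs.length - 1)
    (ModuleCat.of R (QuotSMulTop x M)) (hlt _) k hk fun i hi => ?_
  -- In the long exact sequence of `0 → M → M → M/xM → 0`, `Extⁱ(k, M/xM)` lies between `Extⁱ(k, M)`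
  -- and `Extⁱ⁺¹(k, M)`. Both vanish because `i + 1 < rs.length`.
  have zero1 := AddCommGrpCat.isZero_of_iff_subsingleton.mpr (hext i (by omega))
  have zero2 := AddCommGrpCat.isZero_of_iff_subsingleton.mpr (hext (i + 1) (by omega))
  exact AddCommGrpCat.subsingleton_of_isZero <| ShortComplex.Exact.isZero_of_both_zeros
    (Ext.covariant_sequence_exact₃' k
      (IsSMulRegular.smulShortComplex_shortExact (M := ModuleCat.of R M) hreg) i (i + 1) rfl)
    (zero1.eq_zero_of_src _) (zero2.eq_zero_of_tgt _)

/-- If `y` is regular on `M`, then every associated prime of `M` is contained in an associated prime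
of `M / yM` that contains `y`. -/
theorem exists_isAssociatedPrime_quotSMulTop {y : R} (hy : y ∈ maximalIdeal R)
    (hreg : IsSMulRegular M y) {p : Ideal R} (hp : IsAssociatedPrime p M) :
    ∃ q : Ideal R, IsAssociatedPrime q (QuotSMulTop y M) ∧ p ≤ q ∧ y ∈ q := by
  obtain ⟨hprime, z, hz⟩ := isAssociatedPrime_iff.1 hp
  let N : Submodule R M :=
    { carrier := {m | ∀ a ∈ p, a • m = 0}
      add_mem' := fun h1 h2 a ha => by rw [smul_add, h1 a ha, h2 a ha, add_zero]
      zero_mem' := fun a _ => smul_zero a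
      smul_mem' := fun c m h a ha => by rw [smul_comm, h a ha, smul_zero] }
  have hzN : z ∈ N := fun a ha => by simpa [hz, Submodule.mem_colon_singleton] using ha
  -- `N` consists of the elements killed by `p`. If it lay in `yM`, regularity of `y` would give `N
  -- = yN`, hence `N = 0` by Nakayama, although `z ∈ N` is nonzero. An element of `N` outside `yM`
  -- has a nonzero image killed by `p` and by `y`.
  have hN : ¬ N ≤ y • (⊤ : Submodule R M) := by
    intro hle
    have hle' : N ≤ maximalIdeal R • N := by
      intro m hm
      obtain ⟨m', -, rfl⟩ := hle hm
      refine Submodule.smul_mem_smul hy fun a ha => hreg ?_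
      have := hm a ha
      simp only [smul_zero]
      rw [smul_comm]; exact this
    have : N = ⊥ := Submodule.eq_bot_of_le_smul_of_le_jacobson_bot _ N (IsNoetherian.noetherian N)
      hle' (maximalIdeal_le_jacobson _)
    have hz0 : z = 0 := by simpa [this] using hzN
    exact hprime.ne_top (by simp [hz, hz0])
  obtain ⟨m, hmN, hm⟩ := SetLike.not_le_iff_exists.1 hN
  obtain ⟨q, hq, hle⟩ := exists_le_isAssociatedPrime_of_isNoetherianRing R
    (Submodule.Quotient.mk m : QuotSMulTop y M) (by simpa [Submodule.Quotient.mk_eq_zero] using hm)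
  refine ⟨q, hq, fun a ha => hle ?_, hle ?_⟩
  · rw [Submodule.mem_colon_singleton, ← Submodule.Quotient.mk_smul, hmN a ha]; simp
  · rw [Submodule.mem_colon_singleton, ← Submodule.Quotient.mk_smul, Submodule.mem_bot,
      Submodule.Quotient.mk_eq_zero]
    exact Submodule.smul_mem_pointwise_smul _ _ _ trivial

/-- Since `y` is regular on the domain `R / p`, dividing by it lowers the dimension by exactly one,
and `R / q` is a further quotient. -/
theorem supportDim_quotient_succ_le {p q : Ideal R} [p.IsPrime] (hpq : p ≤ q) {y : R}
    (hyp : y ∉ p) (hyq : y ∈ q) (hy : y ∈ maximalIdeal R) :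
    supportDim R (R ⧸ q) + 1 ≤ supportDim R (R ⧸ p) := by
  have hreg : IsSMulRegular (R ⧸ p) y := by
    rw [isSMulRegular_quotient_iff_mem_of_smul_mem]
    exact fun a ha => (Ideal.IsPrime.mem_or_mem ‹_› ha).resolve_left hyp
  rw [← supportDim_quotSMulTop_succ_eq_supportDim hreg hy]
  gcongr
  have hle : y • (⊤ : Submodule R (R ⧸ p)) ≤ LinearMap.ker (Submodule.factor hpq) := by
    rintro _ ⟨m, -, rfl⟩
    obtain ⟨m, rfl⟩ := Submodule.Quotient.mk_surjective _ m
    exact (Submodule.Quotient.mk_eq_zero q).2 (q.mul_mem_right m hyq)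
  refine supportDim_le_of_surjective (Submodule.liftQ _ (Submodule.factor hpq) hle) ?_
  rw [← LinearMap.range_eq_top, Submodule.range_liftQ, LinearMap.range_eq_top]
  exact Submodule.factor_surjective hpq

/-- The depth of a module is at most the dimension of `R / p` for each associated prime `p`. -/
theorem length_le_supportDim_of_isAssociatedPrime (rs : List R)
    (hmem : ∀ r ∈ rs, r ∈ maximalIdeal R) (hrs : IsWeaklyRegular M rs) {p : Ideal R}
    (hp : IsAssociatedPrime p M) : (rs.length : WithBot ℕ∞) ≤ supportDim R (R ⧸ p) := by
  induction rs generalizing M p with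
  | nil =>
    have := hp.1.ne_top
    have : Nontrivial (R ⧸ p) := Ideal.Quotient.nontrivial_iff.2 this
    rw [List.length_nil, Nat.cast_zero]
    rw [supportDim_eq_ringKrullDim_quotient_annihilator, Ideal.annihilator_quotient]
    exact ringKrullDim_nonneg_of_nontrivial
  | cons y rs ih =>
    obtain ⟨hy, hrs⟩ := (isWeaklyRegular_cons_iff M y rs).1 hrs
    have hmy := hmem y List.mem_cons_self
    obtain ⟨q, hq, hpq, hyq⟩ := exists_isAssociatedPrime_quotSMulTop hmy hy hp
    have h := ih (fun r hr => hmem r (List.mem_cons_of_mem _ hr)) hrs hq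
    have hyp : y ∉ p := fun h => by
      have : y ∈ ⋃ p ∈ associatedPrimes R M, (p : Set R) := Set.mem_biUnion hp h
      rw [biUnion_associatedPrimes_eq_compl_regular] at this
      exact this hy
    have := hp.1
    refine le_trans ?_ (supportDim_quotient_succ_le hpq hyp hyq hmy)
    rw [List.length_cons, Nat.cast_add, Nat.cast_one]
    gcongr

theorem supportDim_le_supportDim_quotient_add_length (rs : List R)
    (hmem : ∀ r ∈ rs, r ∈ maximalIdeal R) :
    supportDim R M ≤ supportDim R (M ⧸ (Ideal.ofList rs • ⊤ : Submodule R M)) + rs.length := by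
  induction rs generalizing M with
  | nil =>
    rw [Ideal.ofList_nil, Submodule.bot_smul]
    simpa using (supportDim_eq_of_equiv (Submodule.quotEquivOfEqBot (⊥ : Submodule R M) rfl)).ge
  | cons x rs ih =>
    rw [supportDim_eq_of_equiv (Submodule.quotOfListConsSMulTopEquivQuotSMulTopInner M x _),
      List.length_cons, Nat.cast_add, Nat.cast_one, ← add_assoc]
    refine (supportDim_le_supportDim_quotSMulTop_succ (hmem x List.mem_cons_self)).trans ?_
    gcongr
    exact ih fun r hr => hmem r (List.mem_cons_of_mem _ hr)

/-- In a finite module of depth at least `d`, every sequence of `d` elements of the maximal ideal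
which cuts the support down to the closed point is regular. -/
theorem isWeaklyRegular_of_support_subset (ys : List R) (hys : ∀ r ∈ ys, r ∈ maximalIdeal R)
    (hreg : IsRegular M ys) (xs : List R) (hxs : ∀ r ∈ xs, r ∈ maximalIdeal R)
    (hlen : xs.length ≤ ys.length)
    (hsupp : ∀ p ∈ Module.support R M, (∀ x ∈ xs, x ∈ p.asIdeal) →
      p.asIdeal = maximalIdeal R) :
    IsWeaklyRegular M xs := by
  induction xs generalizing M ys with
  | nil => exact IsWeaklyRegular.nil R M
  | cons x xs ih =>
    have hmx := hxs x List.mem_cons_self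
    have hmxs := fun r hr => hxs r (List.mem_cons_of_mem _ hr)
    have hx : IsSMulRegular M x := by
      -- Otherwise `x` lies in an associated prime `p`. Then `xs` alone cuts `R / p` down to
      -- dimension at most zero, so `ys.length ≤ dim R/p ≤ xs.length`, one less than `hlen` allows.
      by_contra hx
      have : x ∈ ⋃ p ∈ associatedPrimes R M, (p : Set R) := by
        rwa [biUnion_associatedPrimes_eq_compl_regular]
      obtain ⟨p, hp, hxp⟩ := Set.mem_iUnion₂.1 this
      have h1 := length_le_supportDim_of_isAssociatedPrime ys hys hreg.toIsWeaklyRegular hp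
      have h2 := supportDim_le_supportDim_quotient_add_length (M := R ⧸ p) xs hmxs
      have h3 : supportDim R ((R ⧸ p) ⧸ (Ideal.ofList xs • ⊤ : Submodule R (R ⧸ p))) ≤ 0 := by
        rw [supportDim, Order.krullDim_nonpos_iff_forall_isMax]
        have key : ∀ q ∈ Module.support R ((R ⧸ p) ⧸ (Ideal.ofList xs • ⊤ : Submodule R (R ⧸ p))),
            q.asIdeal = maximalIdeal R := by
          intro q hq
          rw [Module.support_quotient, Module.support_eq_zeroLocus,
            Ideal.annihilator_quotient] at hq
          refine hsupp q ?_ ?_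
          · rw [Module.support_eq_zeroLocus]
            rw [← Submodule.annihilator_top]
            exact (IsAssociatedPrime.annihilator_le hp).trans hq.1
          · intro a ha
            rcases List.mem_cons.1 ha with rfl | ha
            · exact hq.1 hxp
            · exact hq.2 (Ideal.subset_span ha)
        intro a b _
        have : a.1 = b.1 := PrimeSpectrum.ext ((key a.1 a.2).trans (key b.1 b.2).symm)
        exact this.ge
      have h4 : (ys.length : WithBot ℕ∞) ≤ 0 + xs.length := h1.trans (h2.trans (by gcongr))
      rw [zero_add] at h4
      have h5 : ys.length ≤ xs.length := by exact_mod_cast h4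
      rw [List.length_cons] at hlen
      omega
    obtain ⟨zs, hlen', hzs, hzreg⟩ := exists_isRegular_quotSMulTop hmx hx ys hys hreg
    refine IsWeaklyRegular.cons hx (ih zs hzs hzreg hmxs ?_ ?_)
    · rw [List.length_cons] at hlen; omega
    · intro p hp hpx
      rw [Module.support_quotSMulTop] at hp
      refine hsupp p hp.1 fun a ha => ?_
      rcases List.mem_cons.1 ha with rfl | ha
      · exact hp.2 rfl
      · exact hpx a ha

end Depth

/-! ### Consistency and regularity on a quotient -/

section Consistency

open IsLocalRing RingTheory.Sequence Pointwise

variable {R : Type*} [CommRing R] {F : Type*} [AddCommGroup F] [Module R F]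

theorem isWeaklyRegular_concat_iff (rs : List R) (r : R) :
    IsWeaklyRegular F (rs ++ [r]) ↔ IsWeaklyRegular F rs ∧
      IsSMulRegular (F ⧸ (Ideal.ofList rs • ⊤ : Submodule R F)) r := by
  rw [isWeaklyRegular_append_iff, isWeaklyRegular_singleton_iff]

theorem isSMulRegular_quotient_quotient_iff (N : Submodule R F) (I : Ideal R) (r : R) :
    IsSMulRegular ((F ⧸ N) ⧸ (I • ⊤ : Submodule R (F ⧸ N))) r ↔
      ∀ f : F, r • f ∈ N ⊔ I • ⊤ → f ∈ N ⊔ I • ⊤ := by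
  have h : ∀ f : F, N.mkQ f ∈ (I • ⊤ : Submodule R (F ⧸ N)) ↔ f ∈ N ⊔ I • ⊤ := fun f => by
    rw [← Submodule.mem_comap, ← Submodule.range_mkQ N, ← Submodule.map_top, ← Submodule.map_smul'',
      Submodule.comap_map_eq, Submodule.ker_mkQ, sup_comm]
  rw [isSMulRegular_quotient_iff_mem_of_smul_mem, N.mkQ_surjective.forall]
  simp only [← map_smul, h]

theorem mem_ofList_concat_smul (rs : List R) (r : R) (N : Submodule R F) (x : F) :
    x ∈ Ideal.ofList (rs ++ [r]) • N ↔ ∃ y ∈ Ideal.ofList rs • N, ∃ z ∈ N, y + r • z = x := by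
  rw [Ideal.ofList_append, Ideal.ofList_singleton, Submodule.sup_smul,
    Submodule.ideal_span_singleton_smul, Submodule.mem_sup]
  constructor
  · rintro ⟨y, hy, _, ⟨z, hz, rfl⟩, rfl⟩
    exact ⟨y, hy, z, hz, rfl⟩
  · rintro ⟨y, hy, z, hz, rfl⟩
    exact ⟨y, hy, r • z, Submodule.smul_mem_pointwise_smul _ _ _ hz, rfl⟩

/-- If `y + r • z ∈ N` with `y ∈ I'F`, regularity of `r` modulo `N + I'F` gives `z = n + w` with `n
∈ N`, `w ∈ I'F`. The term `r • n` is already in `IN`, and the rest lies in `N ∩ I'F`, where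
induction applies. -/
theorem inf_smul_top_eq_smul_of_isWeaklyRegular (N : Submodule R F) (rs : List R)
    (h : IsWeaklyRegular (F ⧸ N) rs) :
    N ⊓ Ideal.ofList rs • ⊤ = Ideal.ofList rs • N := by
  refine le_antisymm ?_ (le_inf Submodule.smul_le_right (Submodule.smul_mono le_rfl le_top))
  induction rs using List.reverseRecOn with
  | nil => simp
  | append_singleton rs r ih =>
    rw [isWeaklyRegular_concat_iff, isSMulRegular_quotient_quotient_iff] at h
    rintro x ⟨hxN, hx⟩
    obtain ⟨y, hy, z, -, rfl⟩ := (mem_ofList_concat_smul ..).1 hx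
    have hz : z ∈ N ⊔ Ideal.ofList rs • ⊤ := by
      refine h.2 z ?_
      have : r • z = (y + r • z) - y := by abel
      rw [this]
      exact sub_mem (Submodule.mem_sup_left hxN) (Submodule.mem_sup_right hy)
    obtain ⟨n, hn, w, hw, rfl⟩ := Submodule.mem_sup.1 hz
    refine (mem_ofList_concat_smul ..).2 ⟨y + r • w, ih h.1 ⟨?_, ?_⟩, n, hn, ?_⟩
    · have : y + r • w = (y + r • (n + w)) - r • n := by rw [smul_add]; abel
      rw [this]
      exact sub_mem hxN (N.smul_mem r hn)
    · exact add_mem hy (Submodule.smul_mem _ r hw)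
    · rw [smul_add]; abel

theorem isWeaklyRegular_of_inf_smul_top_eq_smul [IsLocalRing R] [IsNoetherianRing R]
    [Module.Finite R F] (N : Submodule R F) (rs : List R) (hmem : ∀ r ∈ rs, r ∈ maximalIdeal R)
    (hF : IsWeaklyRegular F rs) (h : N ⊓ Ideal.ofList rs • ⊤ ≤ Ideal.ofList rs • N) :
    IsWeaklyRegular (F ⧸ N) rs := by
  induction rs using List.reverseRecOn with
  | nil => exact IsWeaklyRegular.nil R _
  | append_singleton rs r ih =>
    rw [isWeaklyRegular_concat_iff, isSMulRegular_quotient_iff_mem_of_smul_mem] at hF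
    rw [isWeaklyRegular_concat_iff, isSMulRegular_quotient_quotient_iff]
    -- The hypothesis descends to the shorter sequence: `x ∈ N ∩ I'F` is `y + r • z` with `y ∈ I'N`,
    -- `z ∈ N`, and regularity of `r` on `F / I'F` forces `z ∈ N ∩ I'F`. So `N ∩ I'F ⊆ I'N + 𝔪(N ∩
    -- I'F)`, and Nakayama concludes.
    have hle : N ⊓ Ideal.ofList rs • ⊤ ≤ Ideal.ofList rs • N := by
      refine Submodule.le_of_le_smul_of_le_jacobson_bot (I := maximalIdeal R)
        (IsNoetherian.noetherian _) (maximalIdeal_le_jacobson _) ?_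
      rintro x ⟨hxN, hx⟩
      obtain ⟨y, hy, z, hz, rfl⟩ := (mem_ofList_concat_smul ..).1 (h ⟨hxN,
        (mem_ofList_concat_smul ..).2 ⟨x, hx, 0, trivial, by simp⟩⟩)
      have hy' : y ∈ Ideal.ofList rs • (⊤ : Submodule R F) := Submodule.smul_mono le_rfl le_top hy
      refine add_mem (Submodule.mem_sup_left hy) (Submodule.mem_sup_right
        (Submodule.smul_mem_smul (hmem r (by simp)) ⟨hz, hF.2 z ?_⟩))
      simpa using sub_mem hx hy'
    refine ⟨ih (fun a ha => hmem a (by simp [ha])) hF.1 hle, fun f hf => ?_⟩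
    -- Here `n = r • f - w` lies in `N ∩ IF = IN`, so `n = y + r • z` with `y ∈ I'N`, `z ∈ N`. Then
    -- `r • (f - z)` lies in `I'F`, hence so does `f - z`.
    obtain ⟨n, hn, w, hw, hnw⟩ := Submodule.mem_sup.1 hf
    obtain ⟨y, hy, z, hz, rfl⟩ := (mem_ofList_concat_smul ..).1 (h ⟨hn,
      (mem_ofList_concat_smul ..).2 ⟨-w, neg_mem hw, f, trivial, by rw [← hnw]; abel⟩⟩)
    have hfz : f - z ∈ Ideal.ofList rs • (⊤ : Submodule R F) := by
      refine hF.2 _ ?_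
      have : r • (f - z) = y + w := by rw [smul_sub, ← hnw]; abel
      rw [this]
      exact add_mem (Submodule.smul_mono le_rfl le_top hy) hw
    rw [← add_sub_cancel z f]
    exact add_mem (Submodule.mem_sup_left hz) (Submodule.mem_sup_right hfz)

end Consistency

/-! ### Maximal minors and the annihilator of the cokernel -/

section Minors

open Matrix

variable {R : Type*} [CommRing R] {s n : ℕ}

/-- Sorting distinct columns costs only a sign; a repeated column makes the determinant vanish. -/
theorem det_submatrix_mem_span_minors (A : Matrix (Fin s) (Fin n) R) (f : Fin s → Fin n) :
    (A.submatrix id f).det ∈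
      Ideal.span (Set.range fun e : Fin s ↪o Fin n => (A.submatrix id e).det) := by
  by_cases hf : Function.Injective f
  · let e : Fin s ↪o Fin n := OrderEmbedding.ofStrictMono (f ∘ Tuple.sort f)
      ((Tuple.monotone_sort f).strictMono_of_injective (hf.comp (Tuple.sort f).injective))
    have h : A.submatrix id e = (A.submatrix id f).submatrix id (Tuple.sort f) := rfl
    have h2 : (A.submatrix id e).det =
        Equiv.Perm.sign (Tuple.sort f) * (A.submatrix id f).det := by
      rw [h, Matrix.det_permute']
    have h3 : (A.submatrix id f).det =
        Equiv.Perm.sign (Tuple.sort f) * (A.submatrix id e).det := by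
      rw [h2, ← mul_assoc, ← Int.cast_mul, ← Units.val_mul, Int.units_mul_self]
      simp
    rw [h3]
    exact Ideal.mul_mem_left _ _ (Ideal.subset_span ⟨e, rfl⟩)
  · simp only [Function.Injective, not_forall] at hf
    obtain ⟨i, j, hij, hne⟩ := hf
    rw [Matrix.det_zero_of_column_eq hne fun k => by simp [hij]]
    exact zero_mem _

/-- A weak Cauchy–Binet formula: multilinear expansion over all choices of columns, without grouping
terms by their image. -/
theorem det_mul_mem_span_minors (A : Matrix (Fin s) (Fin n) R) (B : Matrix (Fin n) (Fin s) R) :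
    (A * B).det ∈
      Ideal.span (Set.range fun e : Fin s ↪o Fin n => (A.submatrix id e).det) := by
  have h : (A * B).det = ∑ f : Fin s → Fin n, (∏ i, B (f i) i) * (A.submatrix id f).det := by
    have h1 : (A * B)ᵀ = fun i => ∑ j, B j i • Aᵀ j := by
      ext i k
      simp [Matrix.mul_apply, mul_comm]
    rw [← Matrix.det_transpose, h1]
    change Matrix.detRowAlternating _ = _
    refine (MultilinearMap.map_sum _ _).trans ?_
    refine Finset.sum_congr rfl fun f _ => ?_
    refine (MultilinearMap.map_smul_univ _ _ _).trans ?_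
    rw [smul_eq_mul]
    congr 1
    rw [← Matrix.det_transpose (A.submatrix id f)]
    rfl
  rw [h]
  exact Ideal.sum_mem _ fun f _ => Ideal.mul_mem_left _ _ (det_submatrix_mem_span_minors A f)

/-- The maximal minors of a matrix annihilate its cokernel. -/
theorem span_minors_le_annihilator (A : Matrix (Fin s) (Fin n) R) :
    Ideal.span (Set.range fun e : Fin s ↪o Fin n => (A.submatrix id e).det) ≤
      Module.annihilator R ((Fin s → R) ⧸ Submodule.span R (Set.range Aᵀ)) := by
  rw [Ideal.span_le]
  rintro _ ⟨e, rfl⟩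
  rw [SetLike.mem_coe, Module.mem_annihilator, (Submodule.mkQ_surjective _).forall]
  intro v
  rw [← map_smul, Submodule.mkQ_apply, Submodule.Quotient.mk_eq_zero]
  set C := A.submatrix id e
  -- Cramer's rule: `det C • v` is a combination of the columns of `C`, which are columns of `A`.
  have h : C.det • v = C *ᵥ (C.adjugate *ᵥ v) := by
    rw [Matrix.mulVec_mulVec, Matrix.mul_adjugate, Matrix.smul_mulVec, Matrix.one_mulVec]
  have h2 : ∀ w, C *ᵥ w = ∑ j, w j • Aᵀ (e j) := by
    intro w
    ext i
    simp [Matrix.mulVec, dotProduct, C, mul_comm]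
  rw [h, h2]
  exact Submodule.sum_mem _ fun j _ => Submodule.smul_mem _ _ (Submodule.subset_span ⟨_, rfl⟩)

/-- The `s`-th powers of the elements that annihilate the cokernel of a matrix with `s` rows are
in the ideal of its maximal minors. -/
theorem pow_mem_span_minors (A : Matrix (Fin s) (Fin n) R) {a : R}
    (ha : a ∈ Module.annihilator R ((Fin s → R) ⧸ Submodule.span R (Set.range Aᵀ))) :
    a ^ s ∈ Ideal.span (Set.range fun e : Fin s ↪o Fin n => (A.submatrix id e).det) := by
  -- Each `a • eᵢ` is a combination of the columns of `A`. Collecting the coefficients gives `A * B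
  -- = a • 1`, of determinant `a ^ s`.
  have h : ∀ i : Fin s, ∃ c : Fin n → R, ∑ j, c j • Aᵀ j = Pi.single i a := by
    intro i
    refine (Submodule.mem_span_range_iff_exists_fun R (v := Aᵀ)).1 ?_
    rw [← Submodule.Quotient.mk_eq_zero]
    have : (Pi.single i a : Fin s → R) = a • Pi.single i 1 := by
      rw [← Pi.single_smul', smul_eq_mul, mul_one]
    rw [this, Submodule.Quotient.mk_smul]
    exact Module.mem_annihilator.1 ha _
  choose c hc using h
  have : A * (Matrix.of c)ᵀ = a • (1 : Matrix (Fin s) (Fin s) R) := by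
    ext k i
    have := congrFun (hc i) k
    simp only [Finset.sum_apply, Pi.smul_apply, smul_eq_mul, Matrix.transpose_apply] at this
    rw [Matrix.smul_apply, Matrix.one_apply, smul_eq_mul, mul_ite, mul_one, mul_zero,
      ← Pi.single_apply, ← this, Matrix.mul_apply]
    exact Finset.sum_congr rfl fun j _ => mul_comm _ _
  have h2 := det_mul_mem_span_minors A (Matrix.of c)ᵀ
  rwa [this, Matrix.det_smul, Matrix.det_one, mul_one, Fintype.card_fin] at h2

end Minors

/-! ### Finite colength in terms of primes -/

section FiniteColength

open IsLocalRing

variable (k : Type*) {R : Type*} [Field k] [CommRing R] [Algebra k R] [IsLocalRing R]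
  [IsNoetherianRing R]

/-- In a Noetherian local `k`-algebra with residue field `k`, an ideal has finite colength if and
only if no prime ideal except the maximal one contains it. -/
theorem finiteDimensional_quotient_iff
    (hk : Function.Surjective (algebraMap k (ResidueField R))) (J : Ideal R) :
    FiniteDimensional k (R ⧸ J) ↔ ∀ p : Ideal R, p.IsPrime → J ≤ p → p = maximalIdeal R := by
  constructor
  · intro h p hp hJp
    have : FiniteDimensional k (R ⧸ p) :=
      Module.Finite.of_surjective (Ideal.Quotient.factorₐ k hJp).toLinearMap
        (Ideal.Quotient.factor_surjective hJp)
    have : IsArtinianRing (R ⧸ p) := IsArtinianRing.of_finite k _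
    have : (⊥ : Ideal (R ⧸ p)).IsMaximal := inferInstance
    exact eq_maximalIdeal (Ideal.Quotient.maximal_of_isField _
      (IsArtinianRing.isField_of_isDomain (R ⧸ p)))
  · intro h
    have : IsArtinianRing (R ⧸ J) := by
      rw [isArtinianRing_iff_isNoetherianRing_krullDimLE_zero]
      refine ⟨inferInstance, Ring.KrullDimLE.mk₀ fun p hp => ?_⟩
      have hmax : (p.comap (Ideal.Quotient.mk J)).IsMaximal := by
        rw [h _ (hp.comap _) (by
          rw [← Ideal.map_le_iff_le_comap, Ideal.map_quotient_self]; exact bot_le)]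
        infer_instance
      have := Ideal.map_eq_top_or_isMaximal_of_surjective (Ideal.Quotient.mk J)
        Ideal.Quotient.mk_surjective hmax
      rw [Ideal.map_comap_of_surjective _ Ideal.Quotient.mk_surjective] at this
      exact this.resolve_left hp.ne_top
    -- For an Artinian ring, finiteness over `k` can be tested modulo the Jacobson radical, where
    -- every element is a constant.
    have hsurj : Function.Surjective (algebraMap k ((R ⧸ J) ⧸ Ring.jacobson (R ⧸ J))) := by
      intro x
      obtain ⟨x, rfl⟩ := Ideal.Quotient.mk_surjective x
      obtain ⟨r, rfl⟩ := Ideal.Quotient.mk_surjective x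
      obtain ⟨c, hc⟩ := hk (residue R r)
      refine ⟨c, ?_⟩
      have hmem : algebraMap k R c - r ∈ maximalIdeal R := by
        rw [← residue_eq_zero_iff, map_sub, sub_eq_zero, ← hc]
        rfl
      refine (Ideal.Quotient.eq (I := Ring.jacobson (R ⧸ J))).2 ?_
      rw [Ring.jacobson_eq_sInf_isMaximal, Submodule.mem_sInf]
      intro p hp
      have := Ideal.comap_isMaximal_of_surjective (Ideal.Quotient.mk J)
        Ideal.Quotient.mk_surjective (K := p) (H := hp)
      rw [← eq_maximalIdeal this] at hmem
      exact hmem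
    have : Module.Finite k ((R ⧸ J) ⧸ Ring.jacobson (R ⧸ J)) :=
      Module.Finite.of_surjective (Algebra.linearMap k _) hsurj
    exact IsSemiprimaryRing.finite_of_isArtinian k (R ⧸ J) (R ⧸ J)

end FiniteColength

/-! ### Functional calculus in commutative Banach algebras -/

noncomputable section

section FunctionalCalculus

variable {W : Type*} [NormedCommRing W] [NormedAlgebra ℂ W] {N : ℕ}

/-- The power series in several elements of a commutative Banach algebra with the coefficients of
a power series in as many complex variables. -/
def FormalMultilinearSeries.inAlgebra (W : Type*) [NormedCommRing W] [NormedAlgebra ℂ W]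
    (p : FormalMultilinearSeries ℂ (Fin N → ℂ) ℂ) :
    FormalMultilinearSeries ℂ (Fin N → W) W := fun m =>
  ∑ j : Fin m → Fin N, p m (fun k => Pi.single (j k) 1) •
    (ContinuousMultilinearMap.mkPiAlgebra ℂ (Fin m) W).compContinuousLinearMap
      (fun k => ContinuousLinearMap.proj (R := ℂ) (φ := fun _ : Fin N => W) (j k))

theorem FormalMultilinearSeries.norm_inAlgebra_le [NormOneClass W]
    (p : FormalMultilinearSeries ℂ (Fin N → ℂ) ℂ) (m : ℕ) : ‖p.inAlgebra W m‖ ≤ N ^ m * ‖p m‖ := by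
  have h : ∀ j : Fin m → Fin N, ‖p m (fun k => Pi.single (j k) 1) •
      (ContinuousMultilinearMap.mkPiAlgebra ℂ (Fin m) W).compContinuousLinearMap
      (fun k => ContinuousLinearMap.proj (R := ℂ) (φ := fun _ : Fin N => W) (j k))‖ ≤ ‖p m‖ := by
    intro j
    rw [norm_smul]
    have h1 : ‖p m (fun k => Pi.single (j k) 1)‖ ≤ ‖p m‖ := by
      refine ((p m).le_opNorm _).trans ?_
      simp [Pi.norm_single]
    have h2 : ‖(ContinuousMultilinearMap.mkPiAlgebra ℂ (Fin m) W).compContinuousLinearMap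
        (fun k => ContinuousLinearMap.proj (R := ℂ) (φ := fun _ : Fin N => W) (j k))‖ ≤ 1 := by
      refine ContinuousMultilinearMap.opNorm_le_bound zero_le_one fun w => ?_
      rw [one_mul, ContinuousMultilinearMap.compContinuousLinearMap_apply,
        ContinuousMultilinearMap.mkPiAlgebra_apply]
      refine (Finset.norm_prod_le _ _).trans ?_
      exact Finset.prod_le_prod (fun _ _ => norm_nonneg _) fun k _ => norm_le_pi_norm (w k) (j k)
    exact (mul_le_mul h1 h2 (norm_nonneg _) (norm_nonneg _)).trans (mul_one _).le
  refine (norm_sum_le _ _).trans ((Finset.sum_le_sum fun j _ => h j).trans ?_)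
  simp

theorem map_inAlgebra_apply (p : FormalMultilinearSeries ℂ (Fin N → ℂ) ℂ) (φ : W →ₐ[ℂ] ℂ)
    (w : Fin N → W) (m : ℕ) :
    φ (p.inAlgebra W m fun _ => w) = p m fun _ i => φ (w i) := by
  have h : (fun i => φ (w i)) = ∑ i, φ (w i) • (Pi.single i 1 : Fin N → ℂ) := by
    ext i
    simp [Finset.sum_apply, Pi.single_apply]
  rw [h, FormalMultilinearSeries.inAlgebra]
  refine Eq.trans ?_ (((p m).toMultilinearMap.map_sum
    (fun (_ : Fin m) (i : Fin N) => φ (w i) • (Pi.single i 1 : Fin N → ℂ))).symm)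
  rw [sum_apply, map_sum]
  refine Finset.sum_congr rfl fun j _ => ?_
  refine Eq.trans ?_ ((p m).toMultilinearMap.map_smul_univ
    (fun k => φ (w (j k))) (fun k => Pi.single (j k) 1)).symm
  simp [map_prod, mul_comm]

variable (W) in
/-- An analytic function of several complex variables can be evaluated at small elements of a
commutative Banach algebra. -/
theorem AnalyticAt.exists_functionalCalculus [NormOneClass W] [CompleteSpace W]
    {f : (Fin N → ℂ) → ℂ} (hf : AnalyticAt ℂ f 0) :
    ∃ r > 0, ∃ Φ : (Fin N → W) → W, AnalyticOnNhd ℂ Φ (Metric.ball 0 r) ∧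
      ∀ w ∈ Metric.ball (0 : Fin N → W) r, ∀ φ : W →ₐ[ℂ] ℂ, (∀ x, ‖φ x‖ ≤ ‖x‖) →
        φ (Φ w) = f fun i => φ (w i) := by
  obtain ⟨p, R, hp⟩ := hf
  obtain ⟨r₀, hr₀, hr₀R⟩ := ENNReal.lt_iff_exists_nnreal_btwn.1 hp.r_pos
  have hr₀' : 0 < r₀ := by exact_mod_cast hr₀
  have hsum := p.summable_norm_mul_pow (hr₀R.trans_le hp.r_le)
  -- The bound on the `m`-th term has a factor `N ^ m`, one for each choice of coordinates, so the
  -- radius shrinks by `N`; `N + 1` avoids dividing by zero.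
  let r : NNReal := r₀ / (N + 1)
  have hr : 0 < r := by positivity
  have hrr₀ : r ≤ r₀ := div_le_self hr₀'.le (by simp)
  have hrad : (r : ENNReal) ≤ (p.inAlgebra W).radius := by
    refine FormalMultilinearSeries.le_radius_of_summable _ ?_
    refine Summable.of_nonneg_of_le (fun m => by positivity) (fun m => ?_) hsum
    calc ‖p.inAlgebra W m‖ * (r : ℝ) ^ m ≤ (N ^ m * ‖p m‖) * (r : ℝ) ^ m := by
          gcongr; exact p.norm_inAlgebra_le m
      _ = ‖p m‖ * (N * r : ℝ) ^ m := by ring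
      _ ≤ ‖p m‖ * (r₀ : ℝ) ^ m := by
          gcongr
          simp only [r, NNReal.coe_div, NNReal.coe_add, NNReal.coe_natCast, NNReal.coe_one]
          rw [mul_div_assoc', div_le_iff₀ (by positivity), mul_comm]
          gcongr
          simp
  have hrad' := (p.inAlgebra W).hasFPowerSeriesOnBall
    ((ENNReal.coe_pos.2 hr).trans_le hrad)
  refine ⟨r, hr, (p.inAlgebra W).sum, ?_, fun w hw φ hφ => ?_⟩
  · refine hrad'.analyticOnNhd.mono ?_
    rw [← Metric.eball_coe]
    exact Metric.eball_subset_eball hrad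
  · have hw' : w ∈ Metric.eball (0 : Fin N → W) r := by rwa [Metric.eball_coe]
    have h1 := hrad'.hasSum (Metric.eball_subset_eball hrad hw')
    have hcont : Continuous φ :=
      (φ.toLinearMap.mkContinuous 1 fun x => by simpa using hφ x).continuous
    have h2 := h1.map φ hcont
    have h3 : (fun i => φ (w i)) ∈ Metric.eball (0 : Fin N → ℂ) R := by
      refine Metric.eball_subset_eball hr₀R.le ?_
      rw [Metric.eball_coe, mem_ball_zero_iff]
      rw [mem_ball_zero_iff] at hw
      refine lt_of_le_of_lt ?_ (hw.trans_le (by exact_mod_cast hrr₀))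
      exact (pi_norm_le_iff_of_nonneg (norm_nonneg _)).2 fun i =>
        (hφ _).trans (norm_le_pi_norm w i)
    have h4 := hp.hasSum h3
    simp only [zero_add] at h2 h4
    refine h2.unique ?_
    rw [← funext fun m => map_inAlgebra_apply p φ w m] at h4
    exact h4

end FunctionalCalculus

/-! ### The disc algebra and division by the coordinate -/

section DiscAlgebra

open Metric

/-- A Banach algebra of functions on the closed unit disc in which every function that vanishes at
the origin is a multiple of the coordinate function. -/
structure DiscFunctions (W : Type*) [NormedCommRing W] [NormedAlgebra ℂ W] where
  /-- Evaluation at a point of the closed unit disc. -/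
  eval : closedBall (0 : ℂ) 1 → W →ₐ[ℂ] ℂ
  norm_eval_le : ∀ z f, ‖eval z f‖ ≤ ‖f‖
  ext_eval : ∀ f g, (∀ z, eval z f = eval z g) → f = g
  /-- The coordinate function. -/
  coord : W
  eval_coord : ∀ z, eval z coord = z
  exists_eq_add_coord_mul : ∀ f, ∃ g, f = algebraMap ℂ W (eval ⟨0, by simp⟩ f) + coord * g
  eq_zero_of_coord_mul : ∀ g, coord * g = 0 → g = 0

/-- The disc algebra: the continuous functions on the closed unit disc that are holomorphic in the
open disc. -/
def discAlgebra : Subalgebra ℂ C(closedBall (0 : ℂ) 1, ℂ) where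
  carrier := {f | ∃ F : ℂ → ℂ, ContinuousOn F (closedBall 0 1) ∧
    DifferentiableOn ℂ F (ball 0 1) ∧ ∀ z : closedBall (0 : ℂ) 1, f z = F z}
  mul_mem' := by
    rintro f g ⟨F, hF, hF', hfF⟩ ⟨G, hG, hG', hgG⟩
    exact ⟨F * G, hF.mul hG, hF'.mul hG', fun z => by simp [hfF, hgG]⟩
  add_mem' := by
    rintro f g ⟨F, hF, hF', hfF⟩ ⟨G, hG, hG', hgG⟩
    exact ⟨F + G, hF.add hG, hF'.add hG', fun z => by simp [hfF, hgG]⟩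
  algebraMap_mem' c := ⟨fun _ => c, continuousOn_const, differentiableOn_const _, fun _ => rfl⟩

namespace discAlgebra

theorem isClosed : IsClosed (discAlgebra : Set C(closedBall (0 : ℂ) 1, ℂ)) := by
  classical
  refine IsSeqClosed.isClosed fun u f hu hf => ?_
  choose G hG hG' hGu using hu
  -- The value off the disc is irrelevant. Holomorphy inside passes to the uniform limit.
  let F : ℂ → ℂ := fun z => if h : z ∈ closedBall (0 : ℂ) 1 then f ⟨z, h⟩ else 0
  have hF : ∀ z : closedBall (0 : ℂ) 1, f z = F z := fun z => by
    simp only [F, dif_pos z.2]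
  refine ⟨F, ?_, ?_, hF⟩
  · rw [continuousOn_iff_continuous_domRestrict]
    convert f.continuous using 1
    ext z
    exact (hF z).symm
  · have h1 : TendstoUniformlyOn G F atTop (closedBall 0 1) := by
      rw [tendstoUniformlyOn_iff_tendstoUniformly_comp_coe]
      have := (ContinuousMap.tendsto_iff_tendstoUniformly).1 hf
      convert this using 1
      · ext n z; exact (hGu n z).symm
      · ext z; exact (hF z).symm
    exact (h1.mono ball_subset_closedBall).tendstoLocallyUniformlyOn.differentiableOn
      (.of_forall hG') isOpen_ball

instance : CompleteSpace discAlgebra := isClosed.completeSpace_coe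

instance : NormOneClass discAlgebra :=
  ⟨(norm_one : ‖(1 : C(closedBall (0 : ℂ) 1, ℂ))‖ = 1)⟩

theorem exists_eq_add_coord_mul {f : C(closedBall (0 : ℂ) 1, ℂ)} (hf : f ∈ discAlgebra) :
    ∃ g ∈ discAlgebra, ∀ z, f z = f ⟨0, by simp⟩ + z * g z := by
  obtain ⟨F, hF, hF', hfF⟩ := hf
  have h0 : ball (0 : ℂ) 1 ∈ 𝓝 0 := ball_mem_nhds _ one_pos
  have h0' : closedBall (0 : ℂ) 1 ∈ 𝓝 0 := closedBall_mem_nhds _ one_pos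
  have hd := (Complex.differentiableOn_dslope h0).2 hF'
  have hc := (continuousOn_dslope h0').2 ⟨hF, hF'.differentiableAt h0⟩
  refine ⟨⟨_, continuousOn_iff_continuous_domRestrict.1 hc⟩, ⟨_, hc, hd, fun _ => rfl⟩,
    fun z => ?_⟩
  change f z = f _ + z * dslope F 0 z
  have := sub_smul_dslope F 0 z
  rw [sub_zero, smul_eq_mul] at this
  rw [this, hfF, hfF]
  ring

theorem eq_zero_of_coord_mul {g : C(closedBall (0 : ℂ) 1, ℂ)} (hg : g ∈ discAlgebra)
    (h : ∀ z : closedBall (0 : ℂ) 1, (z : ℂ) * g z = 0) : g = 0 := by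
  obtain ⟨G, hG, hG', hgG⟩ := hg
  have h2 : ∀ z ∈ closedBall (0 : ℂ) 1, z ≠ 0 → G z = 0 := by
    intro z hz hz0
    exact (hgG ⟨z, hz⟩).symm.trans ((mul_eq_zero.1 (h ⟨z, hz⟩)).resolve_left hz0)
  have h3 : G 0 = 0 := by
    have hcont : Tendsto G (𝓝[≠] 0) (𝓝 (G 0)) :=
      (hG.continuousAt (closedBall_mem_nhds _ one_pos)).tendsto.mono_left nhdsWithin_le_nhds
    refine tendsto_nhds_unique hcont (tendsto_const_nhds.congr' ?_)
    filter_upwards [self_mem_nhdsWithin,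
      nhdsWithin_le_nhds (closedBall_mem_nhds (0 : ℂ) one_pos)] with z hz hz'
    exact (h2 z hz' hz).symm
  ext z
  refine (hgG z).trans ?_
  by_cases hz : (z : ℂ) = 0
  · rw [hz, h3]; rfl
  · exact h2 z z.2 hz

/-- The disc algebra as an algebra of functions on the disc. -/
def discFunctions : DiscFunctions discAlgebra where
  eval z := (ContinuousMap.evalAlgHom ℂ ℂ z).comp discAlgebra.val
  norm_eval_le z f := f.1.norm_coe_le_norm z
  ext_eval _ _ h := Subtype.ext (ContinuousMap.ext h)
  coord := ⟨⟨Subtype.val, continuous_subtype_val⟩, id, continuousOn_id, differentiableOn_id,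
    fun _ => rfl⟩
  eval_coord _ := rfl
  exists_eq_add_coord_mul f := by
    obtain ⟨g, hg, hfg⟩ := exists_eq_add_coord_mul f.2
    exact ⟨⟨g, hg⟩, Subtype.ext (ContinuousMap.ext hfg)⟩
  eq_zero_of_coord_mul g h := Subtype.ext (eq_zero_of_coord_mul g.2 fun z =>
    congrArg (fun f : discAlgebra => (f : C(closedBall (0 : ℂ) 1, ℂ)) z) h)

end discAlgebra

namespace DiscFunctions

variable {W : Type*} [NormedCommRing W] [NormedAlgebra ℂ W] (D : DiscFunctions W)

/-- Evaluation at the origin as a continuous linear functional. -/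
def evalZero : W →L[ℂ] ℂ :=
  (D.eval ⟨0, by simp⟩).toLinearMap.mkContinuous 1 fun f => by
    rw [one_mul]; exact D.norm_eval_le _ f

variable [CompleteSpace W]

/-- The decomposition of a function as its constant term plus a multiple of the coordinate. -/
def constAddCoordMul : (ℂ × W) ≃L[ℂ] W :=
  -- The open mapping theorem makes the inverse continuous, so `divCoord` is bounded.
  ContinuousLinearEquiv.ofBijective
    ((Algebra.linearMap ℂ W).toContinuousLinearMap.coprod (ContinuousLinearMap.mul ℂ W D.coord))
    (by
      rw [LinearMap.ker_eq_bot']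
      rintro ⟨c, g⟩ h
      have h' : algebraMap ℂ W c + D.coord * g = 0 := h
      have hc : c = 0 := by simpa [D.eval_coord] using congrArg (D.eval ⟨0, by simp⟩) h'
      subst hc
      rw [D.eq_zero_of_coord_mul g (by simpa using h')]
      rfl)
    (by
      rw [LinearMap.range_eq_top]
      intro f
      obtain ⟨g, hg⟩ := D.exists_eq_add_coord_mul f
      exact ⟨(_, g), hg.symm⟩)

/-- The quotient of `f - f 0` by the coordinate. -/
def divCoord : W →L[ℂ] W :=
  (ContinuousLinearMap.snd ℂ ℂ W).comp D.constAddCoordMul.symm.toContinuousLinearMap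

theorem eq_add_coord_mul_divCoord (f : W) :
    f = algebraMap ℂ W (D.evalZero f) + D.coord * D.divCoord f := by
  obtain ⟨g, hg⟩ := D.exists_eq_add_coord_mul f
  have : D.divCoord f = g := by
    have h : D.constAddCoordMul (D.evalZero f, g) = f := hg.symm
    rw [divCoord, ContinuousLinearMap.comp_apply]
    conv_lhs => rw [← h]
    simp
  rwa [this]

theorem eq_sum_add_coord_pow_mul (f : W) (b : ℕ) :
    f = ∑ i ∈ Finset.range b, D.evalZero ((D.divCoord ^ i) f) • D.coord ^ i +
      D.coord ^ b * (D.divCoord ^ b) f := by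
  induction b with
  | zero => simp
  | succ b ih =>
    conv_lhs => rw [ih, D.eq_add_coord_mul_divCoord ((D.divCoord ^ b) f)]
    rw [Finset.sum_range_succ, pow_succ' D.divCoord b, mul_apply_eq_comp,
      Algebra.algebraMap_eq_smul_one]
    simp only [mul_add, mul_smul_comm, mul_one]
    ring

/-- Evaluation at `z` as a function of `z` with values in the dual space. -/
def evalCLM (z : ℂ) : W →L[ℂ] ℂ :=
  D.evalZero.comp (Ring.inverse (1 - z • D.divCoord))

theorem one_sub_zero_smul_divCoord : (1 : W →L[ℂ] W) - (0 : ℂ) • D.divCoord = 1 :=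
  sub_eq_self.2 (zero_smul ℂ D.divCoord)

theorem analyticAt_evalCLM : AnalyticAt ℂ D.evalCLM 0 := by
  have h1 : AnalyticAt ℂ (fun z : ℂ => (1 : W →L[ℂ] W) - z • D.divCoord) 0 :=
    analyticAt_const.sub (analyticAt_id.smul analyticAt_const)
  have h2 : AnalyticAt ℂ Ring.inverse ((1 : W →L[ℂ] W) - (0 : ℂ) • D.divCoord) := by
    rw [D.one_sub_zero_smul_divCoord]
    exact analyticAt_inverse (𝕜 := ℂ) (A := W →L[ℂ] W) 1
  exact ((ContinuousLinearMap.compL ℂ W W ℂ D.evalZero).analyticAt _).comp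
    (AnalyticAt.comp (f := fun z : ℂ => (1 : W →L[ℂ] W) - z • D.divCoord) h2 h1)

/-- With `S = divCoord`, evaluating `(1 - z S) g` at `z` gives `g(z) - z (S g)(z) = g(0)`. Inverting
`1 - z S` for small `z` recovers evaluation at `z`, in a form visibly analytic in `z`. -/
theorem evalCLM_eventuallyEq :
    ∀ᶠ z : ℂ in 𝓝 0, ∃ h : z ∈ closedBall (0 : ℂ) 1, ∀ f, D.evalCLM z f = D.eval ⟨z, h⟩ f := by
  have h1 : ∀ᶠ z : ℂ in 𝓝 0, IsUnit ((1 : W →L[ℂ] W) - z • D.divCoord) := by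
    have hc : ContinuousAt (fun z : ℂ => (1 : W →L[ℂ] W) - z • D.divCoord) 0 := by
      fun_prop
    exact hc.eventually_mem (Units.isOpen.mem_nhds (by
      rw [D.one_sub_zero_smul_divCoord]; exact isUnit_one))
  filter_upwards [h1, closedBall_mem_nhds (0 : ℂ) one_pos] with z hz hz1
  refine ⟨hz1, fun f => ?_⟩
  have key : ∀ g, D.eval ⟨z, hz1⟩ ((1 - z • D.divCoord : W →L[ℂ] W) g) = D.evalZero g := by
    intro g
    have := congrArg (D.eval ⟨z, hz1⟩) (D.eq_add_coord_mul_divCoord g)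
    rw [map_add, map_mul, AlgHom.commutes, eval_coord] at this
    simp [this]
  rw [evalCLM, ContinuousLinearMap.comp_apply, ← key, ← mul_apply_eq_comp,
    Ring.mul_inverse_cancel _ hz, one_apply_eq_self]

end DiscFunctions

end DiscAlgebra

end

/-! ### Weierstrass division -/

noncomputable section

section Division

open Metric

namespace DiscFunctions

variable {W : Type*} [NormedCommRing W] [NormedAlgebra ℂ W] (D : DiscFunctions W) {N : ℕ}

/-- The scaled coordinate function together with `N` constants. -/
def coordAndConsts (ρ : ℂ) (y : Fin N → ℂ) : Fin (N + 1) → W :=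
  Fin.cons (ρ • D.coord) fun i => algebraMap ℂ W (y i)

theorem eval_coordAndConsts (ρ : ℂ) (y : Fin N → ℂ) (z : closedBall (0 : ℂ) 1) :
    (fun i => D.eval z (D.coordAndConsts ρ y i)) = Fin.cons (ρ * z) y := by
  ext i
  refine Fin.cases ?_ (fun i => ?_) i
  · simp [coordAndConsts, D.eval_coord]
  · simp [coordAndConsts]

theorem analyticAt_coordAndConsts (ρ : ℂ) :
    AnalyticAt ℂ (D.coordAndConsts ρ : (Fin N → ℂ) → Fin (N + 1) → W) 0 := by
  refine AnalyticAt.pi fun i => ?_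
  refine Fin.cases ?_ (fun i => ?_) i
  · simpa [coordAndConsts] using analyticAt_const
  · exact ((algebraMapCLM ℂ W).comp
        (ContinuousLinearMap.proj (R := ℂ) (φ := fun _ : Fin N => ℂ) i)).analyticAt 0

theorem eventually_coordAndConsts_mem_ball {r : ℝ} (hr : 0 < r) :
    ∀ᶠ ρ : ℂ in 𝓝 0, D.coordAndConsts ρ (0 : Fin N → ℂ) ∈ ball (0 : Fin (N + 1) → W) r := by
  have hc : Continuous fun ρ : ℂ => D.coordAndConsts ρ (0 : Fin N → ℂ) := by
    refine continuous_pi fun i => ?_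
    refine Fin.cases ?_ (fun i => ?_) i
    · exact continuous_id.smul continuous_const
    · simpa [coordAndConsts] using continuous_const
  refine hc.continuousAt.eventually_mem (isOpen_ball.mem_nhds ?_)
  have h0 : D.coordAndConsts 0 (0 : Fin N → ℂ) = 0 := by
    ext i
    refine Fin.cases ?_ (fun i => ?_) i <;> simp [coordAndConsts]
  rw [h0]
  exact mem_ball_self hr

end DiscFunctions

theorem AnalyticAt.clm_apply_apply {E F G : Type*} [NormedAddCommGroup E] [NormedSpace ℂ E]
    [NormedAddCommGroup F] [NormedSpace ℂ F] [NormedAddCommGroup G] [NormedSpace ℂ G]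
    {L : E → F →L[ℂ] G} {v : E → F} {x : E} (hL : AnalyticAt ℂ L x) (hv : AnalyticAt ℂ v x) :
    AnalyticAt ℂ (fun y => L y (v y)) x :=
  ((ContinuousLinearMap.id ℂ (F →L[ℂ] G)).analyticAt_bilinear (L x, v x)).comp₂ hL hv

/-- **Weierstrass division theorem**: division with remainder by an analytic function of `x` which
is equal to `x₀ ^ b` on the first coordinate axis. -/
theorem exists_weierstrass_division {N b : ℕ} {f h : (Fin (N + 1) → ℂ) → ℂ}
    (hf : AnalyticAt ℂ f 0) (hh : AnalyticAt ℂ h 0)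
    (hfb : ∀ᶠ z : ℂ in 𝓝 0, f (Fin.cons z 0) = z ^ b) :
    ∃ q, AnalyticAt ℂ q 0 ∧ ∃ c : ℕ → (Fin N → ℂ) → ℂ, (∀ i, AnalyticAt ℂ (c i) 0) ∧
      ∀ᶠ x in 𝓝 0, h x = q x * f x + ∑ i ∈ Finset.range b, c i (Fin.tail x) * x 0 ^ i := by
  suffices key : ∀ (W : Type) [NormedCommRing W] [NormedAlgebra ℂ W] [NormOneClass W]
      [CompleteSpace W] (D : DiscFunctions W), ∃ q, AnalyticAt ℂ q 0 ∧
      ∃ c : ℕ → (Fin N → ℂ) → ℂ, (∀ i, AnalyticAt ℂ (c i) 0) ∧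
      ∀ᶠ x in 𝓝 0, h x = q x * f x + ∑ i ∈ Finset.range b, c i (Fin.tail x) * x 0 ^ i from
    key discAlgebra discAlgebra.discFunctions
  intro W _ _ _ _ D
  obtain ⟨r₁, hr₁, Φ, hΦ, hΦf⟩ := hf.exists_functionalCalculus W
  obtain ⟨r₂, hr₂, Ψ, hΨ, hΨh⟩ := hh.exists_functionalCalculus W
  obtain ⟨ε, hε, hεb⟩ := eventually_nhds_iff_ball.1 hfb
  -- Scaling by a small `ρ` makes the coordinate small enough for both functional calculi and for
  -- `hfb`; `ρ ≠ 0` allows rescaling back at the end.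
  obtain ⟨ρ, ⟨⟨hρ₁, hρ₂⟩, hρε⟩, hρ0⟩ : ∃ ρ : ℂ, ((D.coordAndConsts ρ (0 : Fin N → ℂ) ∈ ball 0 r₁ ∧
      D.coordAndConsts ρ (0 : Fin N → ℂ) ∈ ball 0 r₂) ∧ ρ ∈ ball 0 ε) ∧ ρ ≠ 0 := by
    have := (((D.eventually_coordAndConsts_mem_ball (N := N) hr₁).and
      (D.eventually_coordAndConsts_mem_ball (N := N) hr₂)).and
      (ball_mem_nhds (0 : ℂ) hε)).filter_mono (nhdsWithin_le_nhds (s := {0}ᶜ))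
    exact (this.and self_mem_nhdsWithin).exists
  have hι := D.analyticAt_coordAndConsts (N := N) ρ
  let F : (Fin N → ℂ) → W := fun y => Φ (D.coordAndConsts ρ y)
  let H : (Fin N → ℂ) → W := fun y => Ψ (D.coordAndConsts ρ y)
  have hF : AnalyticAt ℂ F 0 := (hΦ _ hρ₁).comp hι
  have hH : AnalyticAt ℂ H 0 := (hΨ _ hρ₂).comp hι
  have hFf : ∀ᶠ y in 𝓝 0, ∀ z, D.eval z (F y) = f (Fin.cons (ρ * z) y) := by
    filter_upwards [hι.continuousAt.eventually_mem (isOpen_ball.mem_nhds hρ₁)] with y hy z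
    rw [← D.eval_coordAndConsts]
    exact hΦf _ hy _ (D.norm_eval_le z)
  have hHh : ∀ᶠ y in 𝓝 0, ∀ z, D.eval z (H y) = h (Fin.cons (ρ * z) y) := by
    filter_upwards [hι.continuousAt.eventually_mem (isOpen_ball.mem_nhds hρ₂)] with y hy z
    rw [← D.eval_coordAndConsts]
    exact hΨh _ hy _ (D.norm_eval_le z)
  have hF0 : F 0 = ρ ^ b • D.coord ^ b := by
    refine D.ext_eval _ _ fun z => ?_
    rw [hFf.self_of_nhds, hεb, map_smul, map_pow, D.eval_coord, mul_pow, smul_eq_mul]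
    rw [mem_ball_zero_iff, norm_mul]
    refine lt_of_le_of_lt (mul_le_of_le_one_right (norm_nonneg _) ?_) (mem_ball_zero_iff.1 hρε)
    exact mem_closedBall_zero_iff.1 z.2
  -- Any `w` equals `F 0 * Q w` plus a polynomial in the coordinate of degree less than `b`.
  -- Replacing `F 0` by `F y` turns this identity into the operator `L y`, with `L 0 = 1`. Hence `L
  -- y` is invertible for small `y`, and `G y = (L y)⁻¹ (H y)` supplies quotient and remainder of `H
  -- y`.
  let Q : W →L[ℂ] W := (ρ ^ b)⁻¹ • D.divCoord ^ b
  let L : (Fin N → ℂ) → W →L[ℂ] W := fun y =>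
    1 + (ContinuousLinearMap.compL ℂ W W W).flip Q (ContinuousLinearMap.mul ℂ W (F y - F 0))
  have hL : AnalyticAt ℂ L 0 := by
    refine analyticAt_const.add ?_
    refine (((ContinuousLinearMap.compL ℂ W W W).flip Q).analyticAt _).comp ?_
    exact ((ContinuousLinearMap.mul ℂ W).analyticAt _).comp (hF.sub analyticAt_const)
  have hL0 : L 0 = 1 := by simp [L]
  have hLdef : ∀ y w, L y w = w + (F y - F 0) * Q w := fun y w => rfl
  have hLunit : ∀ᶠ y in 𝓝 0, IsUnit (L y) :=
    hL.continuousAt.eventually_mem (Units.isOpen.mem_nhds (by rw [hL0]; exact isUnit_one))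
  let G : (Fin N → ℂ) → W := fun y => Ring.inverse (L y) (H y)
  have hG : AnalyticAt ℂ G 0 := by
    have hinv : AnalyticAt ℂ Ring.inverse (L 0) := by
      rw [hL0]
      exact analyticAt_inverse (𝕜 := ℂ) (A := W →L[ℂ] W) 1
    exact (hinv.comp hL).clm_apply_apply hH
  have hGH : ∀ᶠ y in 𝓝 0, H y = F y * Q (G y) +
      ∑ i ∈ Finset.range b, D.evalZero ((D.divCoord ^ i) (G y)) • D.coord ^ i := by
    filter_upwards [hLunit] with y hy
    have h1 : L y (G y) = H y := by
      rw [← mul_apply_eq_comp, Ring.mul_inverse_cancel _ hy, one_apply_eq_self]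
    rw [← h1, hLdef]
    have h2 := D.eq_sum_add_coord_pow_mul (G y) b
    have h3 : F 0 * Q (G y) = D.coord ^ b * (D.divCoord ^ b) (G y) := by
      rw [hF0]
      simp only [Q, smul_apply, smul_mul_smul_comm]
      rw [mul_inv_cancel₀ (pow_ne_zero _ hρ0), one_smul]
    rw [sub_mul, h3]
    nth_rewrite 1 [h2]
    ring
  have htail : AnalyticAt ℂ (fun x : Fin (N + 1) → ℂ => Fin.tail x) 0 :=
    AnalyticAt.pi fun i => (ContinuousLinearMap.proj (R := ℂ) (φ := fun _ => ℂ) i.succ).analyticAt 0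
  have hzero : AnalyticAt ℂ (fun x : Fin (N + 1) → ℂ => ρ⁻¹ * x 0) 0 :=
    analyticAt_const.mul
      ((ContinuousLinearMap.proj (R := ℂ) (φ := fun _ => ℂ) (0 : Fin (N + 1))).analyticAt 0)
  have htail0 : Fin.tail (0 : Fin (N + 1) → ℂ) = 0 := rfl
  refine ⟨fun x => D.evalCLM (ρ⁻¹ * x 0) (Q (G (Fin.tail x))), ?_,
    fun i y => (ρ ^ i)⁻¹ * D.evalZero ((D.divCoord ^ i) (G y)), fun i => ?_, ?_⟩
  · have h1 : AnalyticAt ℂ (fun x : Fin (N + 1) → ℂ => D.evalCLM (ρ⁻¹ * x 0)) 0 := by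
      refine AnalyticAt.comp (g := D.evalCLM) (f := fun x : Fin (N + 1) → ℂ => ρ⁻¹ * x 0) ?_ hzero
      simpa using D.analyticAt_evalCLM
    refine h1.clm_apply_apply ((Q.analyticAt _).comp ?_)
    exact AnalyticAt.comp (g := G) (f := fun x : Fin (N + 1) → ℂ => Fin.tail x) hG htail
  · exact analyticAt_const.mul ((D.evalZero.analyticAt _).comp
      (((D.divCoord ^ i).analyticAt _).comp hG))
  · have htend : Tendsto (fun x : Fin (N + 1) → ℂ => Fin.tail x) (𝓝 0) (𝓝 0) := htail.continuousAt
    have hzt : Tendsto (fun x : Fin (N + 1) → ℂ => ρ⁻¹ * x 0) (𝓝 0) (𝓝 0) := by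
      simpa [ContinuousAt] using hzero.continuousAt
    filter_upwards [htend.eventually hFf, htend.eventually hHh, htend.eventually hGH,
      hzt.eventually D.evalCLM_eventuallyEq] with x hx1 hx2 hx3 ⟨hz, hx4⟩
    have hcons : (Fin.cons (ρ * (ρ⁻¹ * x 0)) (Fin.tail x) : Fin (N + 1) → ℂ) = x := by
      rw [mul_inv_cancel_left₀ hρ0, Fin.cons_self_tail]
    have h1 := hx1 ⟨_, hz⟩
    have h2 := hx2 ⟨_, hz⟩
    rw [hcons] at h1 h2
    rw [← h2, ← h1, hx3, map_add, map_mul, map_sum, hx4, mul_comm]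
    congr 1
    refine Finset.sum_congr rfl fun i _ => ?_
    rw [map_smul, map_pow, D.eval_coord, mul_pow, inv_pow, smul_eq_mul]
    ring

end Division

end

/-! ### Noetherianity and the residue field of the ring of germs -/

noncomputable section

/-- For a nonzero `x ∈ I`, the image of `I` in `R / (x)` and `I ∩ (x) = (x)` are both finitely
generated, hence so is `I`. -/
theorem isNoetherianRing_of_quotient_span_singleton {R : Type*} [CommRing R]
    (h : ∀ x : R, x ≠ 0 → IsNoetherianRing (R ⧸ Ideal.span {x})) : IsNoetherianRing R := by
  refine (isNoetherianRing_iff_ideal_fg R).2 fun I => ?_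
  by_cases hI : I = ⊥
  · exact hI ▸ Submodule.fg_bot
  · obtain ⟨x, hx, hx0⟩ := Submodule.exists_mem_ne_zero_of_ne_bot hI
    have := h x hx0
    have h2 : IsNoetherian R (R ⧸ Ideal.span {x}) :=
      (LinearMap.isNoetherian_iff_of_bijective
        ({ toFun := id, map_add' := fun _ _ => rfl, map_smul' := fun _ _ => rfl } :
          (R ⧸ Ideal.span {x}) →ₛₗ[Ideal.Quotient.mk (Ideal.span {x})] (R ⧸ Ideal.span {x}))
        Function.bijective_id).2 this
    refine Submodule.fg_of_fg_map_of_fg_inf_ker (Ideal.span {x}).mkQ (IsNoetherian.noetherian _) ?_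
    rw [Submodule.ker_mkQ, inf_eq_right.2 ((Ideal.span_singleton_le_iff_mem I).2 hx)]
    exact ⟨{x}, by simp⟩

theorem isNoetherianRing_quotient_span_singleton_of_isUnit {R : Type*} [CommRing R] {x : R}
    (hx : IsUnit x) : IsNoetherianRing (R ⧸ Ideal.span {x}) := by
  have : Subsingleton (R ⧸ Ideal.span {x}) :=
    Ideal.Quotient.subsingleton_iff.2 (Ideal.span_singleton_eq_top.2 hx)
  infer_instance

/-- If every element of a ring is congruent modulo `J` to a polynomial of degree less than `b` in
`X` with coefficients in a Noetherian ring, then the quotient by `J` is Noetherian. -/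
theorem isNoetherianRing_quotient_of_forall_exists_sub_sum_mem {A B : Type*} [CommRing A]
    [CommRing B] [IsNoetherianRing A] (τ : A →+* B) (X : B) (b : ℕ) {J : Ideal B}
    (h : ∀ φ, ∃ c : ℕ → A, φ - ∑ i ∈ Finset.range b, τ (c i) * X ^ i ∈ J) :
    IsNoetherianRing (B ⧸ J) := by
  classical
  let := ((Ideal.Quotient.mk J).comp τ).toAlgebra
  have hfin : Module.Finite A (B ⧸ J) := by
    refine ⟨⟨(Finset.range b).image fun i => Ideal.Quotient.mk J (X ^ i), ?_⟩⟩
    rw [eq_top_iff]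
    rintro y -
    obtain ⟨φ, rfl⟩ := Ideal.Quotient.mk_surjective y
    obtain ⟨c, hc⟩ := h φ
    rw [Ideal.Quotient.eq.2 hc, map_sum]
    refine Submodule.sum_mem _ fun i hi => ?_
    rw [map_mul]
    exact Submodule.smul_mem _ (c i)
      (Submodule.subset_span (Finset.mem_coe.2 (Finset.mem_image_of_mem _ hi)))
  exact isNoetherian_of_tower A (isNoetherian_of_isNoetherianRing_of_finite A (B ⧸ J))

namespace AnalyticGerm

theorem of_eq_of_iff {n : ℕ} {f g : (Fin n → ℂ) → ℂ} (hf : AnalyticAt ℂ f 0)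
    (hg : AnalyticAt ℂ g 0) : of f hf = of g hg ↔ f =ᶠ[𝓝 0] g :=
  Subtype.ext_iff.trans Germ.coe_eq

/-- Composition with an analytic map germ `(ℂᵐ, 0) → (ℂⁿ, 0)`. -/
def compHom {m n : ℕ} (u : (Fin m → ℂ) → Fin n → ℂ) (hu : AnalyticAt ℂ u 0) (hu0 : u 0 = 0) :
    AnalyticGerm n →+* AnalyticGerm m where
  toFun φ := ⟨φ.1.compTendsto u (by simpa [hu0] using hu.continuousAt.tendsto), by
    obtain ⟨f, hf, rfl⟩ := exists_rep φ
    exact AnalyticAt.comp (g := f) (f := u) (by rwa [hu0]) hu⟩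
  map_one' := rfl
  map_zero' := rfl
  map_mul' φ ψ := by
    obtain ⟨f, hf, rfl⟩ := exists_rep φ
    obtain ⟨g, hg, rfl⟩ := exists_rep ψ
    rfl
  map_add' φ ψ := by
    obtain ⟨f, hf, rfl⟩ := exists_rep φ
    obtain ⟨g, hg, rfl⟩ := exists_rep ψ
    rfl

/-- A linear change of coordinates. -/
def linearChange {n : ℕ} (A : (Fin n → ℂ) ≃L[ℂ] (Fin n → ℂ)) : AnalyticGerm n ≃+* AnalyticGerm n :=
  RingEquiv.ofRingHom (compHom A (A.toContinuousLinearMap.analyticAt 0) (map_zero A))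
    (compHom A.symm (A.symm.toContinuousLinearMap.analyticAt 0) (map_zero A.symm))
    (by
      ext φ : 1
      obtain ⟨f, hf, rfl⟩ := exists_rep φ
      exact (of_eq_of_iff _ _).2 (.of_forall fun x => congrArg f (A.symm_apply_apply x)))
    (by
      ext φ : 1
      obtain ⟨f, hf, rfl⟩ := exists_rep φ
      exact (of_eq_of_iff _ _).2 (.of_forall fun x => congrArg f (A.apply_symm_apply x)))

theorem analyticAt_tail {n : ℕ} :
    AnalyticAt ℂ (fun x : Fin (n + 1) → ℂ => (Fin.tail x : Fin n → ℂ)) 0 :=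
  AnalyticAt.pi fun i => (ContinuousLinearMap.proj (R := ℂ) (φ := fun _ => ℂ) i.succ).analyticAt 0

theorem analyticAt_apply {n : ℕ} (i : Fin n) : AnalyticAt ℂ (fun x : Fin n → ℂ => x i) 0 :=
  (ContinuousLinearMap.proj (R := ℂ) (φ := fun _ => ℂ) i).analyticAt 0

/-- The germs that do not depend on the first coordinate. -/
def tailHom (n : ℕ) : AnalyticGerm n →+* AnalyticGerm (n + 1) :=
  compHom (fun x => Fin.tail x) analyticAt_tail rfl

theorem isNoetherianRing_quotient_of_regular {n b : ℕ} [IsNoetherianRing (AnalyticGerm n)]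
    {f : (Fin (n + 1) → ℂ) → ℂ} (hf : AnalyticAt ℂ f 0)
    (hfb : ∀ᶠ z : ℂ in 𝓝 0, f (Fin.cons z 0) = z ^ b) :
    IsNoetherianRing (AnalyticGerm (n + 1) ⧸ Ideal.span {of f hf}) := by
  refine isNoetherianRing_quotient_of_forall_exists_sub_sum_mem (tailHom n)
    (of (fun x => x 0) (analyticAt_apply 0)) b fun φ => ?_
  obtain ⟨h, hh, rfl⟩ := exists_rep φ
  obtain ⟨q, hq, c, hc, hqc⟩ := exists_weierstrass_division hf hh hfb
  have han : ∀ s : Finset ℕ, AnalyticAt ℂ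
      (fun x : Fin (n + 1) → ℂ => ∑ i ∈ s, c i (Fin.tail x) * x 0 ^ i) 0 := fun s =>
    Finset.analyticAt_fun_sum _ fun i _ =>
      (AnalyticAt.comp (g := c i) (f := fun x : Fin (n + 1) → ℂ => (Fin.tail x : Fin n → ℂ))
        (hc i) analyticAt_tail).mul ((analyticAt_apply 0).pow i)
  have hsum : ∀ s : Finset ℕ, ∑ i ∈ s, tailHom n (of (c i) (hc i)) *
      of (fun x => x 0) (analyticAt_apply 0) ^ i =
      of (fun x => ∑ i ∈ s, c i (Fin.tail x) * x 0 ^ i) (han s) := by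
    intro s
    induction s using Finset.cons_induction with
    | empty => rfl
    | cons i s hi ih =>
      rw [Finset.sum_cons, ih, eq_comm]
      exact (of_eq_of_iff _ _).2 (.of_forall fun x => Finset.sum_cons hi)
  refine ⟨fun i => of (c i) (hc i), Ideal.mem_span_singleton'.2 ⟨of q hq, ?_⟩⟩
  rw [hsum, eq_sub_iff_add_eq]
  exact ((of_eq_of_iff hh (AnalyticAt.add (hq.mul hf) (han _))).2 hqc).symm

/-- If `f` vanished near `0` on every line, the one-variable identity theorem would carry this along
each line through a whole ball on which `f` is analytic. -/
theorem exists_not_eventually_zero_on_line {n : ℕ} {f : (Fin n → ℂ) → ℂ} (hf : AnalyticAt ℂ f 0)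
    (hf0 : ¬ f =ᶠ[𝓝 0] 0) : ∃ v, ¬ ∀ᶠ t : ℂ in 𝓝 0, f (t • v) = 0 := by
  obtain ⟨r, hr, hball⟩ := Metric.eventually_nhds_iff_ball.1 hf.eventually_analyticAt
  by_contra! h
  refine hf0 (Metric.eventually_nhds_iff_ball.2 ⟨r, hr, fun v hv => ?_⟩)
  by_cases hv0 : v = 0
  · have := (h 0).self_of_nhds
    rw [hv0]
    simpa using this
  have hvpos : 0 < ‖v‖ := norm_pos_iff.2 hv0
  have hmem : ∀ t ∈ Metric.ball (0 : ℂ) (r / ‖v‖), t • v ∈ Metric.ball (0 : Fin n → ℂ) r := by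
    intro t ht
    rw [mem_ball_zero_iff] at ht ⊢
    rwa [norm_smul, ← lt_div_iff₀ hvpos]
  have han : AnalyticOnNhd ℂ (fun t : ℂ => f (t • v)) (Metric.ball 0 (r / ‖v‖)) := by
    intro t ht
    refine AnalyticAt.comp (g := f) (f := fun t : ℂ => t • v) (hball _ (hmem t ht)) ?_
    exact analyticAt_id.smul analyticAt_const
  have h1 := han.eqOn_zero_of_preconnected_of_eventuallyEq_zero
    (convex_ball (0 : ℂ) _).isPreconnected (Metric.mem_ball_self (div_pos hr hvpos)) (h v)
  have h2 := h1 (x := 1) (by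
    rw [mem_ball_zero_iff] at hv ⊢
    rw [norm_one, one_lt_div hvpos]
    exact hv)
  simpa using h2

theorem isNoetherianRing_quotient_span_singleton {n : ℕ} [IsNoetherianRing (AnalyticGerm n)]
    {φ : AnalyticGerm (n + 1)} (hφ : φ ≠ 0) :
    IsNoetherianRing (AnalyticGerm (n + 1) ⧸ Ideal.span {φ}) := by
  obtain ⟨f, hf, rfl⟩ := exists_rep φ
  by_cases hf0 : f 0 = 0
  · have hne : ¬ f =ᶠ[𝓝 0] 0 := fun h => hφ ((of_eq_of_iff hf analyticAt_const).2 h)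
    obtain ⟨v, hv⟩ := exists_not_eventually_zero_on_line hf hne
    have hv0 : v ≠ 0 := by
      rintro rfl
      exact hv (by simp [hf0])
    -- The change of coordinates sends the first axis to a line on which `f` is not identically zero
    -- near `0`.
    obtain ⟨A, hA⟩ := SeparatingDual.exists_continuousLinearEquiv_apply_eq (R := ℂ)
      (x := (Pi.single 0 1 : Fin (n + 1) → ℂ)) (y := v) (by simp) hv0
    have hline : ∀ z : ℂ, A (Fin.cons z 0) = z • v := by
      intro z
      have : (Fin.cons z 0 : Fin (n + 1) → ℂ) = z • Pi.single 0 1 := by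
        ext i
        refine Fin.cases ?_ (fun i => ?_) i <;> simp
      rw [this, map_smul, hA]
    have hfA : AnalyticAt ℂ (f ∘ A) 0 := AnalyticAt.comp (g := f) (f := A)
      (by rwa [map_zero]) (A.toContinuousLinearMap.analyticAt 0)
    have hg : AnalyticAt ℂ (fun z : ℂ => f (z • v)) 0 :=
      AnalyticAt.comp (g := f) (f := fun t : ℂ => t • v) (by rwa [zero_smul])
        (analyticAt_id.smul analyticAt_const)
    obtain ⟨b, u, hu, hu0, hgu⟩ := hg.exists_eventuallyEq_pow_smul_nonzero_iff.2 hv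
    -- On the line, `f` is `z ^ b * u z` with `u 0 ≠ 0`. Multiplying by the unit `(u (x 0))⁻¹`
    -- leaves the ideal unchanged and gives exactly `z ^ b` on the axis, as the division theorem
    -- requires.
    have hU : AnalyticAt ℂ (fun x : Fin (n + 1) → ℂ => (u (x 0))⁻¹) 0 :=
      (AnalyticAt.comp (g := u) (f := fun x : Fin (n + 1) → ℂ => x 0) hu
        (analyticAt_apply 0)).inv hu0
    have hunit : IsUnit (of _ hU) := isUnit_of_ne_zero _ hU (inv_ne_zero hu0)
    have := isNoetherianRing_quotient_of_regular (b := b) (hU.mul hfA) (by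
      filter_upwards [hgu, hu.continuousAt.eventually_ne hu0] with z hz huz
      simp only [Pi.mul_apply, Fin.cons_zero, Function.comp_apply, hline, hz]
      simp only [sub_zero, smul_eq_mul]
      field_simp)
    have hspan : Ideal.span {of _ (hU.mul hfA)} =
        (Ideal.span {of f hf}).map (linearChange A : AnalyticGerm (n + 1) →+* _) := by
      rw [Ideal.map_span, Set.image_singleton]
      exact Ideal.span_singleton_mul_left_unit hunit (of (f ∘ A) hfA)
    exact isNoetherianRing_of_ringEquiv _
      (Ideal.quotientEquiv _ _ (linearChange A) hspan).symm
  · exact isNoetherianRing_quotient_span_singleton_of_isUnit (isUnit_of_ne_zero f hf hf0)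

instance isNoetherianRing (n : ℕ) : IsNoetherianRing (AnalyticGerm n) := by
  induction n with
  | zero =>
    refine isNoetherianRing_of_quotient_span_singleton fun φ hφ => ?_
    obtain ⟨f, hf, rfl⟩ := exists_rep φ
    have hf0 : f 0 ≠ 0 := fun h0 => hφ ((of_eq_of_iff hf analyticAt_const).2
      (.of_forall fun x => by rw [Subsingleton.elim x 0, h0]))
    exact isNoetherianRing_quotient_span_singleton_of_isUnit (isUnit_of_ne_zero f hf hf0)
  | succ n ih =>
    exact isNoetherianRing_of_quotient_span_singleton fun φ hφ =>
      isNoetherianRing_quotient_span_singleton hφ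

theorem algebraMap_residueField_surjective (n : ℕ) :
    Function.Surjective (algebraMap ℂ (IsLocalRing.ResidueField (AnalyticGerm n))) := by
  intro x
  obtain ⟨φ, rfl⟩ := IsLocalRing.residue_surjective x
  obtain ⟨f, hf, rfl⟩ := exists_rep φ
  refine ⟨f 0, ?_⟩
  rw [IsScalarTower.algebraMap_apply ℂ (AnalyticGerm n), IsLocalRing.ResidueField.algebraMap_eq,
    ← sub_eq_zero, ← map_sub, IsLocalRing.residue_eq_zero_iff, IsLocalRing.mem_maximalIdeal]
  rintro ⟨u, hu⟩
  have h1 : u.1 * u⁻¹.1 = 1 := u.mul_inv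
  rw [hu] at h1
  have := congrArg (fun φ : AnalyticGerm n => (φ : Germ (𝓝 (0 : Fin n → ℂ)) ℂ).value) h1
  obtain ⟨g, hg, hgu⟩ := exists_rep u⁻¹.1
  rw [hgu] at this
  have h2 : (f 0 - f 0) * g 0 = 1 := this
  simp at h2

end AnalyticGerm

end

/-! ### The equivalence of the three conditions -/

theorem Ideal.pi_univ_eq_smul_top {R ι : Type*} [CommRing R] [Fintype ι] (I : Ideal R) :
    Submodule.pi Set.univ (fun _ : ι => I) = I • (⊤ : Submodule R (ι → R)) := by
  classical
  refine le_antisymm (fun x hx => ?_) (Submodule.smul_le.2 fun r hr x _ i _ => ?_)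
  · rw [pi_eq_sum_univ' x]
    exact Submodule.sum_mem _ fun i _ => Submodule.smul_mem_smul (hx i trivial) trivial
  · exact I.mul_mem_right _ hr

theorem exists_isRegular_of_moduleDepth_eq {R M : Type*} [CommRing R] [IsLocalRing R]
    [AddCommGroup M] [Module R M] [Nontrivial M] {d : ℕ} (h : moduleDepth R M = d) :
    ∃ rs : List R, rs.length = d ∧ (∀ r ∈ rs, r ∈ IsLocalRing.maximalIdeal R) ∧
      RingTheory.Sequence.IsRegular M rs := by
  have hne : Nonempty {rs : List R // (∀ r ∈ rs, r ∈ IsLocalRing.maximalIdeal R) ∧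
      RingTheory.Sequence.IsRegular M rs} :=
    ⟨[], by simp, RingTheory.Sequence.IsRegular.nil R M⟩
  rw [moduleDepth, iSup_subtype'] at h
  obtain ⟨rs, hrs⟩ := ENat.exists_eq_iSup_of_lt_top (by rw [h]; exact ENat.natCast_lt_top d)
  rw [h] at hrs
  exact ⟨rs.1, by exact_mod_cast hrs, rs.2⟩

open AnalyticGerm IsLocalRing in
theorem theorem3p7 {n s d : ℕ} (hsn : s ≤ n) (g : Fin s → AnalyticGerm n)
    (hdim : Module.supportDim (AnalyticGerm n)
      ((Fin s → AnalyticGerm n) ⧸ AnalyticGerm.jacobianModule g) = d)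
    (hCM : IsCohenMacaulayModule (AnalyticGerm n)
      ((Fin s → AnalyticGerm n) ⧸ AnalyticGerm.jacobianModule g))
    (hd : 1 ≤ d)
    (lam : Fin d → AnalyticGerm n)
    (hlam : RingTheory.Sequence.IsRegular (AnalyticGerm n) (List.ofFn lam))
    (I : Ideal (AnalyticGerm n)) (hI : I = Ideal.span (Set.range lam)) :
    List.TFAE [
      AnalyticGerm.IsConsistent I g,
      FiniteDimensional ℂ (AnalyticGerm n ⧸ (AnalyticGerm.jacobianMinors g ⊔ I)),
      RingTheory.Sequence.IsRegular
        ((Fin s → AnalyticGerm n) ⧸ AnalyticGerm.jacobianModule g) (List.ofFn lam)] := by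
  set M := (Fin s → AnalyticGerm n) ⧸ AnalyticGerm.jacobianModule g with hM
  have hIlist : I = Ideal.ofList (List.ofFn lam) := by
    rw [hI, Ideal.ofList]
    congr 1
    ext x
    simp [List.mem_ofFn]
  have hmem : ∀ r ∈ List.ofFn lam, r ∈ maximalIdeal (AnalyticGerm n) := by
    intro r hr
    refine le_maximalIdeal (J := Ideal.ofList (List.ofFn lam)) (fun h => hlam.top_ne_smul ?_)
      (Ideal.subset_span hr)
    rw [h, Submodule.top_smul]
  have hnt : Nontrivial M := by
    rw [← Module.supportDim_ne_bot_iff_nontrivial (AnalyticGerm n), hdim]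
    exact WithBot.coe_ne_bot
  have hweak : RingTheory.Sequence.IsRegular M (List.ofFn lam) ↔
      RingTheory.Sequence.IsWeaklyRegular M (List.ofFn lam) :=
    ⟨fun h => h.toIsWeaklyRegular,
      RingTheory.Sequence.IsRegular.of_isWeaklyRegular_of_mem_maximalIdeal M hmem⟩
  have hcons : IsConsistent I g ↔ jacobianModule g ⊓ Ideal.ofList (List.ofFn lam) • ⊤ =
      Ideal.ofList (List.ofFn lam) • jacobianModule g := by
    rw [IsConsistent, Ideal.pi_univ_eq_smul_top, hIlist]
  have hspan : jacobianModule g =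
      Submodule.span (AnalyticGerm n) (Set.range (jacobianMatrix g).transpose) := rfl
  have hsupp : ∀ p : PrimeSpectrum (AnalyticGerm n),
      p ∈ Module.support (AnalyticGerm n) M ↔ jacobianMinors g ≤ p.asIdeal := by
    intro p
    rw [Module.support_eq_zeroLocus, PrimeSpectrum.mem_zeroLocus, SetLike.coe_subset_coe]
    constructor
    · exact fun h => (span_minors_le_annihilator (jacobianMatrix g)).trans h
    · exact fun h a ha => p.2.mem_of_pow_mem s (h (pow_mem_span_minors (jacobianMatrix g) ha))
  have hIle : ∀ J : Ideal (AnalyticGerm n), I ≤ J ↔ ∀ x ∈ List.ofFn lam, x ∈ J := by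
    intro J
    rw [hIlist, Ideal.ofList, Ideal.span_le]
    rfl
  have hfin := finiteDimensional_quotient_iff ℂ (algebraMap_residueField_surjective n)
    (jacobianMinors g ⊔ I)
  tfae_have 3 → 1 := fun h =>
    hcons.2 (inf_smul_top_eq_smul_of_isWeaklyRegular _ _ h.toIsWeaklyRegular)
  tfae_have 1 → 3 := by
    intro h
    refine hweak.2 (isWeaklyRegular_of_inf_smul_top_eq_smul _ _ hmem ?_ (hcons.1 h).le)
    -- Regularity passes from `R` to `R^s` by tensoring with this flat module.
    exact (TensorProduct.rid (AnalyticGerm n) (Fin s → AnalyticGerm n)).isWeaklyRegular_congr _ |>.1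
      hlam.toIsWeaklyRegular.isWeaklyRegular_lTensor
  -- The Cohen–Macaulay hypothesis supplies a regular sequence of length `d`, as long as `λ`, to
  -- compare with.
  tfae_have 2 → 3 := by
    intro h
    have hdepth : moduleDepth (AnalyticGerm n) M = d := by
      have := (hCM.2.resolve_left (not_subsingleton M)).trans hdim
      exact_mod_cast this
    obtain ⟨ys, hlen, hys, hreg⟩ := exists_isRegular_of_moduleDepth_eq hdepth
    refine hweak.2 (isWeaklyRegular_of_support_subset ys hys hreg _ hmem (by simp [hlen]) ?_)
    intro p hp hpx
    exact hfin.1 h p.asIdeal p.2 (sup_le ((hsupp p).1 hp) ((hIle _).2 hpx))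
  tfae_have 3 → 2 := by
    intro h
    refine hfin.2 fun p hp hle => ?_
    have hdim' := Module.supportDim_add_length_eq_supportDim_of_isRegular _ h
    rw [hdim, List.length_ofFn] at hdim'
    -- The `d` regular elements use up the whole dimension `d`, so `M / IM` is supported at the
    -- closed point only.
    have h0 := ENat.WithBot.add_natCast_cancel.1 (hdim'.trans (zero_add _).symm)
    have hq : (⟨p, hp⟩ : PrimeSpectrum (AnalyticGerm n)) ∈ Module.support (AnalyticGerm n)
        (M ⧸ (Ideal.ofList (List.ofFn lam) • ⊤ : Submodule (AnalyticGerm n) M)) := by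
      rw [Module.support_quotient, ← hIlist]
      exact ⟨(hsupp _).2 (le_sup_left.trans hle), le_sup_right.trans hle⟩
    rw [support_of_supportDim_eq_zero _ _ h0] at hq
    exact ((maximalIdeal.isMaximal _).eq_of_le hp.ne_top hq).symm
  tfae_finish
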